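/- A \emph{unit disk graph} is a finite simple graph whose vertices can be mapped to points of the Euclidean plane so that two distinct vertices are adjacent if and only if their points are at Euclidean distance at most $1$. A graph $G$ is called \emph{$(k,\ell)$-pendant} if there is a vertex $v$ of $G$ such that $k$ vertices of degree $1$ are adjacent to $v$ and $\ell$ vertices of degree $1$ are at graph distance exactly $2$ from $v$ (that is, there are at least $k$, respectively at least $\ell$, such vertices). Lemma. If $G$ is a $(3,\ell)$-pendant unit disk graph, then $\ell \leq 16$. -/

import Mathlib

/-- A graph is a unit disk graph if its vertices can be mapped to points of the Euclidean plane so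
that two distinct vertices are adjacent exactly when their points are at distance at most `1`. -/
def SimpleGraph.IsUnitDiskGraph {V : Type*} (G : SimpleGraph V) : Prop :=
  ∃ p : V → EuclideanSpace ℝ (Fin 2),
    ∀ u w : V, u ≠ w → (G.Adj u w ↔ Dist.dist (p u) (p w) ≤ 1)

/-- The open `r`-neighborhood of `v`: the vertices at graph distance exactly `r` from `v`
(vertices in other components are at distance `⊤`). -/
def SimpleGraph.openNbhd {V : Type*} (G : SimpleGraph V) (r : ℕ) (v : V) : Set V :=
  {w | G.edist v w = r}

/-- `v` is a generator witnessing that `G` is `(k, l)`-pendant: there are `k` vertices of degree `1`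
in the open neighborhood of `v`, and `l` vertices of degree `1` in the open `2`-neighborhood
of `v`. -/
def SimpleGraph.IsPendantGenerator {V : Type*} (G : SimpleGraph V) [G.LocallyFinite]
    (k l : ℕ) (v : V) : Prop :=
  (∃ A : Finset V, A.card = k ∧ ∀ w ∈ A, w ∈ G.neighborSet v ∧ G.degree w = 1) ∧
  (∃ B : Finset V, B.card = l ∧ ∀ w ∈ B, w ∈ G.openNbhd 2 v ∧ G.degree w = 1)

/-- `G` is `(k, l)`-pendant. -/
def SimpleGraph.IsPendant {V : Type*} (G : SimpleGraph V) [G.LocallyFinite] (k l : ℕ) : Prop :=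
  ∃ v : V, G.IsPendantGenerator k l v

/-! Put `v` at the origin. The pendant neighbours `A` lie in the unit disk, the pendants `B` in the
annulus of radii 1 and 2, and all these points are more than 1 apart. Seen from `v`, directions in
`A` are over `π / 3` apart and those of `A` and `B` at least `π / 6` apart
(`Complex.re_le_of_norm_sub`, the key step). Cut the annulus at radius `3 / 2`, and pack disjoint
arcs around the directions of `A` and of one ring into the circle: the outer ring holds at most 9
points, the inner at most 7. -/

/-! ### Angles and arcs on the circle -/

open Complex in
lemma lt_dist_arg_of_re_lt {z w : ℂ} (hz : z ≠ 0) (hw : w ≠ 0) {r : ℝ} (hr : r ≤ Real.pi)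
    (h : z.re * w.re + z.im * w.im < Real.cos r * (‖z‖ * ‖w‖)) :
    r < dist (z.arg : AddCircle (2 * Real.pi)) (w.arg : AddCircle (2 * Real.pi)) := by
  have hz' : 0 < ‖z‖ := norm_pos_iff.2 hz
  have hw' : 0 < ‖w‖ := norm_pos_iff.2 hw
  by_contra! hle
  rw [dist_eq_norm, ← AddCircle.coe_sub] at hle
  have hcos : Real.cos ‖((z.arg - w.arg : ℝ) : AddCircle (2 * Real.pi))‖ =
      Real.cos (z.arg - w.arg) := by
    rw [AddCircle.norm_eq, Real.cos_abs, Real.cos_sub_int_mul_two_pi]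
  have hmono := Real.cos_le_cos_of_nonneg_of_le_pi (norm_nonneg _) hr hle
  rw [hcos, Real.cos_sub, Complex.cos_arg hz, Complex.cos_arg hw, Complex.sin_arg,
    Complex.sin_arg] at hmono
  have : z.re / ‖z‖ * (w.re / ‖w‖) + z.im / ‖z‖ * (w.im / ‖w‖) =
      (z.re * w.re + z.im * w.im) / (‖z‖ * ‖w‖) := by field_simp
  rw [this, le_div_iff₀ (by positivity)] at hmono
  linarith

open MeasureTheory in
lemma AddCircle.sum_le_of_pairwise_lt_dist {ι : Type*} (s : Finset ι) {T : ℝ} [hT : Fact (0 < T)]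
    (θ : ι → AddCircle T) (c : ι → ℝ) (hc : ∀ i ∈ s, 0 ≤ c i) (hc' : ∀ i ∈ s, 2 * c i ≤ T)
    (h : ∀ i ∈ s, ∀ j ∈ s, i ≠ j → c i + c j < dist (θ i) (θ j)) :
    ∑ i ∈ s, 2 * c i ≤ T := by
  have hd : (s : Set ι).PairwiseDisjoint fun i => Metric.closedBall (θ i) (c i) :=
    fun i hi j hj hij => Metric.closedBall_disjoint_closedBall (h i hi j hj hij)
  have hvol := measure_biUnion_finset (μ := volume) hd
    fun i _ => Metric.isClosed_closedBall.measurableSet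
  have hle : volume (⋃ i ∈ s, Metric.closedBall (θ i) (c i)) ≤ ENNReal.ofReal T := by
    rw [← AddCircle.measure_univ]; exact measure_mono (Set.subset_univ _)
  -- `hc'` keeps a ball from wrapping around, so its length is exactly `2 * c i`.
  rw [hvol, Finset.sum_congr rfl (g := fun i => ENNReal.ofReal (2 * c i)) fun i hi => by
      rw [AddCircle.volume_closedBall, min_eq_right (hc' i hi)],
    ← ENNReal.ofReal_sum_of_nonneg fun i hi => by linarith [hc i hi]] at hle
  exact (ENNReal.ofReal_le_ofReal_iff hT.out.le).1 hle

/-! ### The angle between a pendant neighbour and a far pendant -/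

/-- A point within distance `1` of both corners `(k, ±h)` of the lens of the unit disks centred at
`(0, 0)` and `(2k, 0)` is within distance `1` of the whole lens. -/
lemma sq_dist_le_one_of_mem_lens {k h p q x y : ℝ} (hk : 0 ≤ k) (hh : 0 ≤ h)
    (hkh : k ^ 2 + h ^ 2 = 1) (ha : p ^ 2 + q ^ 2 ≤ 2 * k * p - 2 * h * |q|)
    (hu : x ^ 2 + y ^ 2 ≤ 1) (hu' : (x - 2 * k) ^ 2 + y ^ 2 ≤ 1) :
    (p - x) ^ 2 + (q - y) ^ 2 ≤ 1 := by
  -- Both conditions are recentred at the lens centre `(k, 0)`; the extra terms absorb the cross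
  -- terms of the distance.
  have hx : (x - k) ^ 2 + y ^ 2 + 2 * k * |x - k| ≤ h ^ 2 := by
    rcases abs_cases (x - k) with ⟨e, _⟩ | ⟨e, _⟩ <;> rw [e] <;> nlinarith
  have hp : (p - k) ^ 2 + q ^ 2 + 2 * h * |q| ≤ k ^ 2 := by nlinarith
  have hxk := mul_nonneg hk (abs_nonneg (x - k))
  have hhq := mul_nonneg hh (abs_nonneg q)
  have hy : |y| ≤ h := abs_le_of_sq_le_sq (by linarith [sq_nonneg (x - k)]) hh
  have hpk : |p - k| ≤ k := abs_le_of_sq_le_sq (by linarith [sq_nonneg q]) hk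
  have h1 : -((p - k) * (x - k)) ≤ |p - k| * |x - k| := by
    rw [← abs_mul]; exact neg_le_abs _
  have h2 : -(q * y) ≤ |q| * |y| := by
    rw [← abs_mul]; exact neg_le_abs _
  have h3 := mul_le_mul_of_nonneg_right hpk (abs_nonneg (x - k))
  have h4 := mul_le_mul_of_nonneg_left hy (abs_nonneg q)
  nlinarith

/-- In polar form `a = t (c, σ)`, the conclusion puts `a` within 1 of the far corner `(k, -h)`. The
convex quadratic `Q t = |a - w|² - 1`, with `w = (2k, 0)`, is nonpositive at `t₀` and at 1, hence
between them, which contradicts `hw` if `t₀ < t`. -/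
lemma lens_corner_aux {k h c σ t : ℝ} (hk : 1 / 2 ≤ k) (hh : 0 ≤ h) (hkh : k ^ 2 + h ^ 2 = 1)
    (hc : 0 ≤ c) (hσ : 0 ≤ σ) (hσ' : σ ≤ 1 / 2) (hcσ : c ^ 2 + σ ^ 2 = 1) (ht : t ≤ 1)
    (hw : 1 < t ^ 2 - 4 * k * (t * c) + 4 * k ^ 2) : t ≤ 2 * (k * c - h * σ) := by
  by_contra! hlt
  obtain ⟨t₀, ht₀⟩ : ∃ t₀, t₀ = 2 * (k * c - h * σ) := ⟨_, rfl⟩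
  rw [← ht₀] at hlt
  -- This is `Q 1 ≤ 0`; if `c < k`, then `t₀ ≥ 2 (c² - σ²) ≥ 1 ≥ t`.
  have hkc : k ≤ c := by
    by_contra! hck
    have hhσ : h ≤ σ := by
      refine le_of_sq_le_sq ?_ hσ
      nlinarith
    nlinarith [mul_le_mul_of_nonneg_right hhσ hσ, mul_le_mul_of_nonneg_right hck.le hc]
  have hQ₀ : t₀ ^ 2 - 4 * k * (t₀ * c) + 4 * k ^ 2 - 1 = 4 * σ ^ 2 - 1 := by
    have hc2 : c ^ 2 = 1 - σ ^ 2 := by linarith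
    have hh2 : h ^ 2 = 1 - k ^ 2 := by linarith
    have : t₀ ^ 2 - 4 * k * (t₀ * c) = 4 * (h ^ 2 * σ ^ 2 - k ^ 2 * c ^ 2) := by rw [ht₀]; ring
    rw [this, hc2, hh2]; ring
  have e1 : 0 ≤ (1 - t) * (1 - 4 * σ ^ 2) := mul_nonneg (by linarith) (by nlinarith)
  have e2 : 0 ≤ (t - t₀) * (4 * k * (c - k)) :=
    mul_nonneg (by linarith) (mul_nonneg (by linarith) (by linarith))
  have e3 : 0 ≤ (1 - t₀) * ((t - t₀) * (1 - t)) :=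
    mul_nonneg (by linarith) (mul_nonneg (by linarith) (by linarith))
  have e4 : 0 < (1 - t₀) * (t ^ 2 - 4 * k * (t * c) + 4 * k ^ 2 - 1) :=
    mul_pos (by linarith) (by linarith)
  have e5 : (1 - t₀) * (t ^ 2 - 4 * k * (t * c) + 4 * k ^ 2 - 1) =
      (1 - t) * (t₀ ^ 2 - 4 * k * (t₀ * c) + 4 * k ^ 2 - 1) - (t - t₀) * (4 * k * (c - k))
      - (1 - t₀) * ((t - t₀) * (1 - t)) := by ring
  rw [hQ₀] at e5
  linarith

/-- At an angle below `π / 6`, `a` would be within 1 of both lens corners, hence of the point `u =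
(x, y)` of the lens. -/
lemma le_sqrt_three_div_two_mul_of_lens {s t p q x y : ℝ} (hs : 1 < s) (ht : 0 < t)
    (htpq : t ^ 2 = p ^ 2 + q ^ 2) (ht1 : t ≤ 1) (haw : 1 < (p - s) ^ 2 + q ^ 2)
    (hu : x ^ 2 + y ^ 2 ≤ 1) (hu' : (x - s) ^ 2 + y ^ 2 ≤ 1) (hau : 1 < (p - x) ^ 2 + (q - y) ^ 2) :
    p ≤ √3 / 2 * t := by
  by_contra! hlt
  have h3 : √3 ^ 2 = 3 := Real.sq_sqrt (by norm_num)
  have hp : 0 < p := lt_trans (by positivity) hlt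
  have hs2 : s ≤ 2 := by nlinarith [sq_nonneg (x - s / 2), sq_nonneg y]
  obtain ⟨k, rfl⟩ : ∃ k, s = 2 * k := ⟨s / 2, by ring⟩
  have hkh : k ^ 2 + √(1 - k ^ 2) ^ 2 = 1 := by
    rw [Real.sq_sqrt (by nlinarith)]; ring
  have hpq : (p / t) ^ 2 + (|q| / t) ^ 2 = 1 := by
    rw [div_pow, div_pow, sq_abs, ← add_div, ← htpq, div_self (by positivity)]
  have hpt : √3 / 2 < p / t := (lt_div_iff₀ ht).2 hlt
  have hq : |q| / t ≤ 1 / 2 := by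
    have := pow_le_pow_left₀ (by positivity) hpt.le 2
    rw [div_pow, h3] at this
    exact le_of_sq_le_sq (by linarith) (by norm_num)
  have key := lens_corner_aux (k := k) (h := √(1 - k ^ 2)) (c := p / t) (σ := |q| / t) (t := t)
    (by linarith) (Real.sqrt_nonneg _) hkh (by positivity) (by positivity) hq hpq ht1
    (by rw [mul_div_cancel₀ _ ht.ne']; nlinarith)
  refine hau.not_ge (sq_dist_le_one_of_mem_lens (k := k) (h := √(1 - k ^ 2)) (by linarith)
    (Real.sqrt_nonneg _) hkh ?_ hu hu')
  have := mul_le_mul_of_nonneg_left key ht.le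
  have e : t * (2 * (k * (p / t) - √(1 - k ^ 2) * (|q| / t))) =
      2 * k * p - 2 * √(1 - k ^ 2) * |q| := by field_simp
  rw [e] at this
  nlinarith

lemma Complex.sq_norm_sub_eq (z w : ℂ) :
    ‖z - w‖ ^ 2 = ‖z‖ ^ 2 + ‖w‖ ^ 2 - 2 * (z.re * w.re + z.im * w.im) := by
  simp only [Complex.sq_norm, Complex.normSq_apply, Complex.sub_re, Complex.sub_im]; ring

/-- The directions of `a` and `w` make an angle of at least `π / 6`. -/
lemma Complex.re_le_of_norm_sub {a u w : ℂ} (ha : ‖a‖ ≤ 1) (hw : 1 < ‖w‖) (hu : ‖u‖ ≤ 1)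
    (huw : ‖u - w‖ ≤ 1) (haw : 1 < ‖a - w‖) (hau : 1 < ‖a - u‖) :
    a.re * w.re + a.im * w.im ≤ √3 / 2 * (‖a‖ * ‖w‖) := by
  rcases eq_or_ne a 0 with rfl | ha0
  · simp
  set s := ‖w‖ with hs
  have hs0 : (s : ℂ) ≠ 0 := by exact_mod_cast (by linarith : s ≠ 0)
  -- Multiplication by `e` rotates `w` onto the positive real axis.
  obtain ⟨e, he⟩ : ∃ e : ℂ, e = (starRingEnd ℂ) w / s := ⟨_, rfl⟩
  have hen : ‖e‖ = 1 := by
    rw [he, norm_div, RCLike.norm_conj, Complex.norm_real, Real.norm_eq_abs, abs_of_pos (by linarith),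
      ← hs, div_self (by linarith)]
  have hwe : w * e = s := by
    rw [he, mul_div_assoc', Complex.mul_conj, Complex.normSq_eq_norm_sq, ← hs]
    push_cast; field_simp
  have hn : ∀ z : ℂ, ‖z‖ ^ 2 = (z * e).re ^ 2 + (z * e).im ^ 2 := fun z => by
    rw [← mul_one ‖z‖, ← hen, ← norm_mul, Complex.sq_norm, Complex.normSq_apply]; ring
  have hnw : ∀ z : ℂ, ‖z - w‖ ^ 2 = ((z * e).re - s) ^ 2 + (z * e).im ^ 2 := fun z => by
    rw [hn, sub_mul, hwe]; simp
  have hae : (a * e).re = (a.re * w.re + a.im * w.im) / s := by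
    have : a * e = a * (starRingEnd ℂ) w / s := by rw [he]; ring
    rw [this, Complex.div_ofReal_re]; simp
  have key := le_sqrt_three_div_two_mul_of_lens (s := s) (t := ‖a‖) (p := (a * e).re)
    (q := (a * e).im) (x := (u * e).re) (y := (u * e).im) hw (norm_pos_iff.2 ha0) (hn a) ha
    (by rw [← hnw]; exact one_lt_pow₀ haw two_ne_zero)
    (by rw [← hn]; exact pow_le_one₀ (norm_nonneg _) hu)
    (by rw [← hnw]; exact pow_le_one₀ (norm_nonneg _) huw)
    (by
      have := hn (a - u)
      rw [sub_mul, Complex.sub_re, Complex.sub_im] at this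
      rw [← this]; exact one_lt_pow₀ hau two_ne_zero)
  rw [hae, div_le_iff₀ (by linarith)] at key
  linarith

/-- Directions of points of an annulus at distance more than `1` from each other are separated. -/
lemma Complex.re_lt_of_one_lt_norm_sub {z w : ℂ} {C : ℝ} (h : 1 < ‖z - w‖)
    (hC : ‖z‖ ^ 2 + ‖w‖ ^ 2 - 1 ≤ 2 * C * (‖z‖ * ‖w‖)) :
    z.re * w.re + z.im * w.im < C * (‖z‖ * ‖w‖) := by
  have := one_lt_pow₀ h two_ne_zero
  rw [Complex.sq_norm_sub_eq] at this
  linarith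

/-! ### Packing and counting -/

/-- Arcs of half-width `α` around `A` and `β` around `W` are disjoint. -/
lemma Finset.card_mul_add_card_mul_le_pi {ι : Type*} {A W : Finset ι} (hAW : Disjoint A W)
    (f : ι → ℂ) {α β : ℝ} (hα : 0 ≤ α) (hα' : α ≤ 1) (hβ : 0 ≤ β) (hβ' : β ≤ 1)
    (hA₀ : ∀ i ∈ A, f i ≠ 0) (hW₀ : ∀ i ∈ W, f i ≠ 0)
    (hAA : ∀ i ∈ A, ∀ j ∈ A, i ≠ j →
      (f i).re * (f j).re + (f i).im * (f j).im < Real.cos (α + α) * (‖f i‖ * ‖f j‖))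
    (hA_W : ∀ i ∈ A, ∀ j ∈ W,
      (f i).re * (f j).re + (f i).im * (f j).im < Real.cos (α + β) * (‖f i‖ * ‖f j‖))
    (hWW : ∀ i ∈ W, ∀ j ∈ W, i ≠ j →
      (f i).re * (f j).re + (f i).im * (f j).im < Real.cos (β + β) * (‖f i‖ * ‖f j‖)) :
    A.card * α + W.card * β ≤ Real.pi := by
  classical
  have hpi := Real.pi_gt_three
  have : Fact (0 < 2 * Real.pi) := ⟨by positivity⟩
  have hdisj : ∀ i ∈ W, i ∉ A := fun i hi hi' => Finset.disjoint_left.1 hAW hi' hi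
  let c : ι → ℝ := fun i => if i ∈ A then α else β
  have hcA : ∀ i ∈ A, c i = α := fun i hi => if_pos hi
  have hcW : ∀ i ∈ W, c i = β := fun i hi => if_neg (hdisj i hi)
  have hc : ∀ i, 0 ≤ c i ∧ c i ≤ 1 := fun i => by
    by_cases hi : i ∈ A
    · rw [hcA i hi]; exact ⟨hα, hα'⟩
    · simp only [c, if_neg hi]; exact ⟨hβ, hβ'⟩
  have key := AddCircle.sum_le_of_pairwise_lt_dist (A ∪ W) (T := 2 * Real.pi)
    (fun i => ((f i).arg : AddCircle (2 * Real.pi))) c (fun i _ => (hc i).1)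
    (fun i _ => by linarith [(hc i).2]) fun i hi j hj hij => by
      have hcπ : c i + c j ≤ Real.pi := by linarith [(hc i).2, (hc j).2]
      rcases Finset.mem_union.1 hi with hi | hi <;> rcases Finset.mem_union.1 hj with hj | hj
      · refine lt_dist_arg_of_re_lt (hA₀ i hi) (hA₀ j hj) hcπ ?_
        rw [hcA i hi, hcA j hj]; exact hAA i hi j hj hij
      · refine lt_dist_arg_of_re_lt (hA₀ i hi) (hW₀ j hj) hcπ ?_
        rw [hcA i hi, hcW j hj]; exact hA_W i hi j hj
      · rw [dist_comm, add_comm]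
        refine lt_dist_arg_of_re_lt (hA₀ j hj) (hW₀ i hi) (by linarith) ?_
        rw [hcA j hj, hcW i hi]; exact hA_W j hj i hi
      · refine lt_dist_arg_of_re_lt (hW₀ i hi) (hW₀ j hj) hcπ ?_
        rw [hcW i hi, hcW j hj]; exact hWW i hi j hj hij
  rw [Finset.sum_union hAW, Finset.sum_congr rfl fun i hi => by rw [hcA i hi],
    Finset.sum_congr (s₁ := W) rfl fun i hi => by rw [hcW i hi], Finset.sum_const,
    Finset.sum_const, nsmul_eq_mul, nsmul_eq_mul] at key
  linarith

lemma SimpleGraph.eq_of_adj_of_degree_eq_one {V : Type*} {G : SimpleGraph V} {x y z : V}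
    [Fintype (G.neighborSet x)] (hx : G.degree x = 1) (hy : G.Adj x y) (hz : G.Adj x z) :
    y = z := by
  obtain ⟨w, _, hw⟩ := (SimpleGraph.degree_eq_one_iff_existsUnique_adj).1 hx
  rw [hw y hy, hw z hz]

lemma SimpleGraph.of_mem_openNbhd_two {V : Type*} {G : SimpleGraph V} {v w : V}
    (h : w ∈ G.openNbhd 2 v) : w ≠ v ∧ ¬ G.Adj v w ∧ ∃ u, G.Adj v u ∧ G.Adj u w := by
  have h2 : G.edist v w = 2 := h
  refine ⟨?_, ?_, ?_⟩
  · rintro rfl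
    simp at h2
  · intro hadj
    rw [SimpleGraph.edist_eq_one_iff_adj.2 hadj] at h2
    norm_num at h2
  · have hreach : G.Reachable v w := by
      rw [← SimpleGraph.edist_ne_top_iff_reachable, h2]; decide
    obtain ⟨q, hq⟩ := hreach.exists_walk_length_eq_edist
    rw [h2] at hq
    have hq : q.length = 2 := by exact_mod_cast hq
    match q, hq with
    | .cons h₁ (.cons h₂ .nil), _ => exact ⟨_, h₁, h₂⟩

lemma card_le_sixteen_of_annulus {ι : Type*} {A B : Finset ι} (hAB : Disjoint A B)
    (f : ι → ℂ) (hA : A.card = 3) (hA₁ : ∀ i ∈ A, ‖f i‖ ≤ 1)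
    (hB₁ : ∀ i ∈ B, 1 < ‖f i‖)
    (hAA : ∀ i ∈ A, ∀ j ∈ A, i ≠ j → 1 < ‖f i - f j‖)
    (hBB : ∀ i ∈ B, ∀ j ∈ B, i ≠ j → 1 < ‖f i - f j‖)
    (hA_B : ∀ i ∈ A, ∀ j ∈ B, 1 < ‖f i - f j‖)
    (hu : ∀ j ∈ B, ∃ u : ℂ, ‖u‖ ≤ 1 ∧ ‖u - f j‖ ≤ 1 ∧ ∀ i ∈ A, 1 < ‖f i - u‖) :
    B.card ≤ 16 := by
  classical
  have hpi := Real.pi_lt_d2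
  have hpi' := Real.pi_gt_d2
  have hB₂ : ∀ i ∈ B, ‖f i‖ ≤ 2 := fun i hi => by
    obtain ⟨u, hu1, hu2, -⟩ := hu i hi
    have := norm_sub_norm_le (f i) u
    rw [norm_sub_rev] at this
    linarith
  -- A point of `A` at the origin would be within 1 of the others.
  have hA₀ : ∀ i ∈ A, f i ≠ 0 := fun i hi h0 => by
    obtain ⟨j, hj, hji⟩ := Finset.exists_mem_ne (by omega : 1 < A.card) i
    have := hAA j hj i hi hji
    rw [h0, sub_zero] at this
    exact this.not_ge (hA₁ j hj)
  have hB₀ : ∀ i ∈ B, f i ≠ 0 := fun i hi => norm_pos_iff.1 (by linarith [hB₁ i hi])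
  have hcos : ∀ {x C : ℝ}, C ≤ 1 - x ^ 2 / 2 → C ≤ Real.cos x := fun h =>
    h.trans (Real.one_sub_sq_div_two_le_cos)
  have hAcos : ∀ {α : ℝ}, 1 / 2 ≤ Real.cos (α + α) → ∀ i ∈ A, ∀ j ∈ A, i ≠ j →
      (f i).re * (f j).re + (f i).im * (f j).im < Real.cos (α + α) * (‖f i‖ * ‖f j‖) :=
    fun hα i hi j hj hij => (Complex.re_lt_of_one_lt_norm_sub (C := 1 / 2) (hAA i hi j hj hij) (by
      have h1 := hA₁ i hi
      have h2 := hA₁ j hj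
      have h3 := norm_nonneg (f i)
      have h4 := norm_nonneg (f j)
      nlinarith [mul_nonneg h3 (sub_nonneg.2 h1), mul_nonneg h4 (sub_nonneg.2 h2),
        mul_nonneg (sub_nonneg.2 h1) (sub_nonneg.2 h2)])).trans_le
      (mul_le_mul_of_nonneg_right hα (by positivity))
  -- `13 / 25` is just below `π / 6` and equals `α + β` for both rings.
  have hABcos : √3 / 2 < Real.cos (13 / 25) := by
    rw [← Real.cos_pi_div_six]
    exact Real.cos_lt_cos_of_nonneg_of_le_pi (by norm_num) (by linarith) (by linarith)
  have hABlt : ∀ i ∈ A, ∀ j ∈ B,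
      (f i).re * (f j).re + (f i).im * (f j).im < Real.cos (13 / 25) * (‖f i‖ * ‖f j‖) := by
    intro i hi j hj
    obtain ⟨u, hu1, hu2, hu3⟩ := hu j hj
    exact (Complex.re_le_of_norm_sub (hA₁ i hi) (hB₁ j hj) hu1 hu2 (hA_B i hi j hj)
      (hu3 i hi)).trans_lt (mul_lt_mul_of_pos_right hABcos
        (mul_pos (norm_pos_iff.2 (hA₀ i hi)) (norm_pos_iff.2 (hB₀ j hj))))
  have hsub : ∀ (P : ι → Prop) [DecidablePred P], ∀ i ∈ B.filter P, i ∈ B := fun P _ i hi => (Finset.mem_filter.1 hi).1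
  have outer := Finset.card_mul_add_card_mul_le_pi (A := A) (W := B.filter fun i => 3 / 2 < ‖f i‖)
    (hAB.mono_right (Finset.filter_subset _ _)) f (α := 27 / 100) (β := 1 / 4)
    (by norm_num) (by norm_num) (by norm_num) (by norm_num) hA₀ (fun i hi => hB₀ i (hsub _ i hi))
    (hAcos (hcos (by norm_num)))
    (fun i hi j hj => by
      have := hABlt i hi j (hsub _ j hj)
      norm_num at this ⊢; exact this)
    (fun i hi j hj hij => by
      have hi' := (Finset.mem_filter.1 hi).2
      have hj' := (Finset.mem_filter.1 hj).2
      have hi₂ := hB₂ i (hsub _ i hi)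
      have hj₂ := hB₂ j (hsub _ j hj)
      -- The maximum of `(s² + t² - 1) / (2st)` on `[3/2, 2]²` is `7 / 8 = 1 - (2β)² / 2`.
      refine (Complex.re_lt_of_one_lt_norm_sub (C := 7 / 8)
        (hBB i (hsub _ i hi) j (hsub _ j hj) hij) ?_).trans_le
        (mul_le_mul_of_nonneg_right (hcos (by norm_num)) (by positivity))
      nlinarith [mul_nonneg (sub_nonneg.2 hi'.le) (sub_nonneg.2 hi₂),
        mul_nonneg (sub_nonneg.2 hj'.le) (sub_nonneg.2 hj₂),
        mul_nonneg (sub_nonneg.2 hi'.le) (sub_nonneg.2 hj'.le),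
        mul_nonneg (sub_nonneg.2 hi₂) (sub_nonneg.2 hj₂),
        mul_nonneg (sub_nonneg.2 hi'.le) (sub_nonneg.2 hj₂),
        mul_nonneg (sub_nonneg.2 hi₂) (sub_nonneg.2 hj'.le)])
  have inner' := Finset.card_mul_add_card_mul_le_pi (A := A)
    (W := B.filter fun i => ¬ 3 / 2 < ‖f i‖)
    (hAB.mono_right (Finset.filter_subset _ _)) f (α := 19 / 100) (β := 33 / 100)
    (by norm_num) (by norm_num) (by norm_num) (by norm_num) hA₀ (fun i hi => hB₀ i (hsub _ i hi))
    (hAcos (hcos (by norm_num)))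
    (fun i hi j hj => by
      have := hABlt i hi j (hsub _ j hj)
      norm_num at this ⊢; exact this)
    (fun i hi j hj hij => by
      have hi' := not_lt.1 (Finset.mem_filter.1 hi).2
      have hj' := not_lt.1 (Finset.mem_filter.1 hj).2
      have hi₁ := (hB₁ i (hsub _ i hi)).le
      have hj₁ := (hB₁ j (hsub _ j hj)).le
      -- On `[1, 3/2]²` the maximum is `7 / 9`, at `s = t = 3/2`.
      refine (Complex.re_lt_of_one_lt_norm_sub (C := 7 / 9)
        (hBB i (hsub _ i hi) j (hsub _ j hj) hij) ?_).trans_le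
        (mul_le_mul_of_nonneg_right (hcos (by norm_num)) (by positivity))
      nlinarith [mul_nonneg (sub_nonneg.2 hi₁) (sub_nonneg.2 hi'),
        mul_nonneg (sub_nonneg.2 hj₁) (sub_nonneg.2 hj'),
        mul_nonneg (sub_nonneg.2 hi₁) (sub_nonneg.2 hj₁),
        mul_nonneg (sub_nonneg.2 hi') (sub_nonneg.2 hj'),
        mul_nonneg (sub_nonneg.2 hi₁) (sub_nonneg.2 hj'),
        mul_nonneg (sub_nonneg.2 hi') (sub_nonneg.2 hj₁)])
  rw [hA] at outer inner'
  -- `0.81 + 0.25 n ≤ π` gives `n ≤ 9`; below, `0.57 + 0.33 n ≤ π` gives `n ≤ 7`.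
  have h9 : (B.filter fun i => 3 / 2 < ‖f i‖).card < 10 := by
    rw [← Nat.cast_lt (α := ℝ)]; push_cast at outer ⊢; linarith
  have h7 : (B.filter fun i => ¬ 3 / 2 < ‖f i‖).card < 8 := by
    rw [← Nat.cast_lt (α := ℝ)]; push_cast at inner' ⊢; linarith
  have := Finset.card_filter_add_card_filter_not (s := B) (fun i => 3 / 2 < ‖f i‖)
  omega

theorem mainTheorem8 {V : Type*} [Fintype V] (G : SimpleGraph V) [DecidableRel G.Adj]
    (hG : G.IsUnitDiskGraph) (l : ℕ) (hl : G.IsPendant 3 l) : l ≤ 16 := by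
  obtain ⟨p, hp⟩ := hG
  obtain ⟨v, ⟨A, hA, hA'⟩, B, rfl, hB'⟩ := hl
  have hAv : ∀ a ∈ A, G.Adj a v := fun a ha => ((hA' a ha).1 : G.Adj v a).symm
  have hAuniq : ∀ a ∈ A, ∀ x, G.Adj a x → x = v := fun a ha x hx =>
    SimpleGraph.eq_of_adj_of_degree_eq_one (hA' a ha).2 hx (hAv a ha)
  have hB := fun w hw => SimpleGraph.of_mem_openNbhd_two (hB' w hw).1
  let e := Complex.orthonormalBasisOneI.repr.symm
  have hnorm : ∀ x y, ‖e (p x - p v) - e (p y - p v)‖ = dist (p x) (p y) := fun x y => by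
    rw [← map_sub, LinearIsometryEquiv.norm_map, sub_sub_sub_cancel_right, dist_eq_norm]
  have hnorm' : ∀ x, ‖e (p x - p v)‖ = dist (p x) (p v) := fun x => by
    rw [LinearIsometryEquiv.norm_map, dist_eq_norm]
  have hfar : ∀ x y, x ≠ y → ¬ G.Adj x y → 1 < dist (p x) (p y) := fun x y hxy h =>
    not_le.1 fun h' => h ((hp x y hxy).2 h')
  have hnear : ∀ x y, G.Adj x y → dist (p x) (p y) ≤ 1 := fun x y h => (hp x y h.ne).1 h
  refine card_le_sixteen_of_annulus (A := A) (B := B) ?_ (fun x => e (p x - p v)) hA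
    ?_ ?_ ?_ ?_ ?_ ?_
  · exact Finset.disjoint_left.2 fun a ha hb => (hB a hb).2.1 (hAv a ha).symm
  · intro a ha
    rw [hnorm']; exact hnear _ _ (hAv a ha)
  · intro b hb
    rw [hnorm']; exact hfar _ _ (hB b hb).1 fun h => (hB b hb).2.1 h.symm
  · intro a ha a' ha' hne
    rw [hnorm]
    exact hfar _ _ hne fun h => (hAv a' ha').ne (hAuniq a ha a' h)
  · intro b hb b' hb' hne
    rw [hnorm]
    refine hfar _ _ hne fun h => ?_
    -- The only neighbour of `b` is `u`, so `b' = u` would be adjacent to `v`.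
    obtain ⟨u, hvu, hub⟩ := (hB b hb).2.2
    obtain rfl := SimpleGraph.eq_of_adj_of_degree_eq_one (hB' b hb).2 h hub.symm
    exact (hB b' hb').2.1 hvu
  · intro a ha b hb
    rw [hnorm]
    refine hfar _ _ ?_ fun h => (hB b hb).1 (hAuniq a ha b h)
    rintro rfl
    exact (hB a hb).2.1 (hAv a ha).symm
  · intro b hb
    obtain ⟨u, hvu, hub⟩ := (hB b hb).2.2
    refine ⟨e (p u - p v), ?_, ?_, fun a ha => ?_⟩
    · rw [hnorm']; exact hnear _ _ hvu.symm
    · rw [hnorm]; exact hnear _ _ hub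
    · rw [hnorm]
      refine hfar _ _ ?_ fun h => hvu.ne (hAuniq a ha u h).symm
      rintro rfl
      exact (hB b hb).1 (hAuniq a ha b hub)
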